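/- Setting. Transfer functions are scalar functions $F(z,\lambda)$ on the torus $|z|=|\lambda|=1$ ($z$ spatial, $\lambda$ temporal), with normalized Haar measure and $L_2$ norm $\|F\|^2=\frac1{4\pi^2}\int\!\!\int|F(e^{i\theta},e^{iw})|^2\,dw\,d\theta$. Write $F=\sum_{i\in\mathbb Z}F_i(\lambda)z^i$ and let $\hat f(i,t)$ be the coefficient of $z^i\lambda^t$. $H_2$ is the space of $f\in L_2$ of the $\lambda$-circle with no negative powers of $\lambda$; $\Pi$ is the orthogonal projection of $L_2$ onto $H_2$, and $\|f\|_{H_2^\perp}=\|(I-\Pi)f\|$. $F$ is *stable* if it is bounded and $\hat f(i,t)=0$ for all $i$ and all $t<0$. $F\in L_2$ is *cone causal* if $F_i=\lambda^{|i|}\tilde f_i$ with $\tilde f_i\in H_2$ for every $i$. A controller $K$ (not necessarily stable) has the cone structure if it is a formal series $K=\sum_{k\ge0}\bigl(\sum_{|n|\le k}k_{n,k}z^n\bigr)\lambda^k$; a cone causal $F$ is identified with its series. Fix $p\in[2,\infty]$. A cone causal series is *$p$-stable* if it is the series of a cone causal $F$ in $L_p$ of the torus ($p=2$: square-summable impulse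 response; $p=\infty$: bounded operator). A cone-structured $K$ is *$p$-stabilizing* if $I-G_{yu}K$ is invertible as a formal series and $(I-G_{yu}K)^{-1}$, $K(I-G_{yu}K)^{-1}$, $G_{yu}(I-G_{yu}K)^{-1}$ are $p$-stable. Let $G_{zw},G_{zu},G_{yw},G_{yu}$ be stable, $G_{yu}$ cone causal, $T_{zw}=G_{zw}+G_{zu}K(I-G_{yu}K)^{-1}G_{yw}$, $T_1=G_{zw}$, $T_2=G_{zu}G_{yw}$. Let $T_2=T_{2in}T_{2out}$, where $T_{2in}$ is inner (stable, multiplication by it is an isometry of $L_2$), and $T_{2out}$ is stable, cone causal and causally invertible ($1/T_{2out}$ is stable). Write $T_{2in}^*T_1=\sum_i\tilde T_i(\lambda)z^i$ and $$\tilde\eta_i=\Pi\Bigl[\frac{\tilde T_i}{\lambda^{|i|}}\Bigr],\qquad Q=\frac{\sum_i\lambda^{|i|}\tilde\eta_i(\lambda)z^i}{T_{2out}},\qquad K=-Q(I-G_{yu}Q)^{-1}.$$ Claim. 1. The series for $T_{2in}^*T_1$ converges in $L_2$. For every cone causal $Q'\in L_2$ there are $h_i\in H_2$ with $\sum_i\|h_i\|^2<\infty$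 such that $(T_{2out}Q')_i=\lambda^{|i|}h_i$ for all $i$ and $\|T_1-T_2Q'\|^2=\sum_i\|\tilde T_i-\lambda^{|i|}h_i\|^2$. Conversely, every family $h_i\in H_2$ with $\sum_i\|h_i\|^2<\infty$ arises from some cone causal $Q'\in L_2$ in this way. 2. For each $i$, $\min_{h\in H_2}\|\tilde T_i-\lambda^{|i|}h\|^2=\bigl\|\tilde T_i/\lambda^{|i|}\bigr\|^2_{H_2^\perp}$, attained at $h=\tilde\eta_i$. 3. The sum $\sum_i\lambda^{|i|}\tilde\eta_iz^i$ converges in $L_2$ to $T_{2out}Q$, $Q\in L_2$ is cone causal, and the sum $$J_{opt}^2=\sum_{i}\Bigl\|\frac{\tilde T_i}{\lambda^{|i|}}\Bigr\|^2_{H_2^\perp}\qquad(J_{opt}\ge0)$$ is finite, is the minimum of $\sum_i\|\tilde T_i-\lambda^{|i|}h_i\|^2$ over all families $h_i\in H_2$ for which it is finite, and $\|T_1-T_2Q\|=J_{opt}$. For every $p\in[2,\infty]$, $J_{opt}=\inf\|T_1-T_2Q'\|$ over all cone causal $Q'\in L_p$; so $Q$ attains the infimum for $p=2$, and for every $p$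 with $Q\in L_p$. 4. For every $p\in[2,\infty]$, $J_{opt}=\inf\|T_{zw}\|$ over all cone-structured $p$-stabilizing $K$. The series $I-G_{yu}Q$ is invertible if and only if $\hat g_{yu}(0,0)\,\hat q(0,0)\ne1$ (in particular when $\hat g_{yu}(0,0)=0$). If it is invertible and $Q\in L_p$ (automatic for $p=2$), then $K=-Q(I-G_{yu}Q)^{-1}$ is cone-structured and $p$-stabilizing, and attains this infimum. -/

import Mathlib

open MeasureTheory
open scoped ENNReal LaurentPolynomial PowerSeries

noncomputable section

/-! ### The circle, the torus, and multiplication of transfer functions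

A point of the torus is a pair `(θ, w)`; the spatial variable is `z = e^{2πiθ}` and the temporal
variable is `λ = e^{2πiw}`.  Both circles carry the normalized Haar measure, so that the norm of
`Lp ℂ 2 torusMeasure` is `((2π)⁻² ∫∫ |G(e^{iθ}, e^{iw})|² dw dθ)^{1/2}`. -/

/-- Normalized Haar measure on the unit circle. -/
abbrev circleMeasure : Measure UnitAddCircle := AddCircle.haarAddCircle

/-- Normalized Haar measure on the torus (spatial circle times temporal circle). -/
abbrev torusMeasure : Measure (UnitAddCircle × UnitAddCircle) :=
  circleMeasure.prod circleMeasure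

/-- Pointwise product of a bounded function and an `L^p` function (a.e. classes). -/
def lmul {α : Type*} [MeasurableSpace α] {μ : Measure α} {p : ℝ≥0∞}
    (G : Lp ℂ ∞ μ) (F : Lp ℂ p μ) : Lp ℂ p μ :=
  ((Lp.memLp F).smul (Lp.memLp G)).toLp (⇑G • ⇑F)

/-- A bounded function, seen as an element of `L²` of the torus. -/
def toL2 (G : Lp ℂ ∞ torusMeasure) : Lp ℂ 2 torusMeasure :=
  ((Lp.memLp G).mono_exponent le_top).toLp G

/-- Multiplication by `λ^n` (`n` any integer) on `L²` of the temporal circle. -/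
def lambdaMul (n : ℤ) (f : Lp ℂ 2 circleMeasure) : Lp ℂ 2 circleMeasure :=
  lmul (fourierLp ∞ n) f

theorem memLp_spatialCoeff {F : UnitAddCircle × UnitAddCircle → ℂ}
    (hF : MemLp F 2 torusMeasure) (i : ℤ) :
    MemLp (fun w => fourierCoeff (fun θ => F (θ, w)) i) 2 circleMeasure := by
  have haesm : AEStronglyMeasurable
      (fun x : UnitAddCircle × UnitAddCircle => (fourier (-i) x.1 : ℂ) • F x) torusMeasure :=
    ((fourier (-i)).continuous.comp continuous_fst).aestronglyMeasurable.smul hF.1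
  have hmeas : AEStronglyMeasurable
      (fun w => fourierCoeff (fun θ => F (θ, w)) i) circleMeasure :=
    haesm.prod_swap.integral_prod_right'
  have hslice : ∀ᵐ w ∂circleMeasure,
      AEStronglyMeasurable (fun θ => F (θ, w)) circleMeasure :=
    hF.1.prod_swap.prodMk_left
  refine ⟨hmeas, ?_⟩
  rw [eLpNorm_lt_top_iff_lintegral_rpow_enorm_lt_top (by norm_num) (by norm_num)]
  have hfin := (eLpNorm_lt_top_iff_lintegral_rpow_enorm_lt_top
    (p := 2) (by norm_num) (by norm_num)).1 hF.2
  rw [lintegral_prod_symm _ (hF.1.enorm.pow_const _)] at hfin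
  refine lt_of_le_of_lt (lintegral_mono_ae ?_) hfin
  filter_upwards [hslice] with w hw
  have h1 : ‖fourierCoeff (fun θ => F (θ, w)) i‖ₑ
      ≤ eLpNorm (fun θ => F (θ, w)) 1 circleMeasure := by
    rw [eLpNorm_one_eq_lintegral_enorm]
    refine (enorm_integral_le_lintegral_enorm _).trans (le_of_eq ?_)
    refine lintegral_congr fun θ => ?_
    rw [← ofReal_norm, ← ofReal_norm, norm_smul, fourier_apply, Circle.norm_coe, one_mul]
  have h2 := h1.trans (eLpNorm_le_eLpNorm_of_exponent_le (q := 2) (by norm_num) hw)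
  have h3 := ENNReal.rpow_le_rpow h2 (z := (2 : ℝ≥0∞).toReal) (by norm_num)
  refine h3.trans (le_of_eq ?_)
  rw [eLpNorm_eq_lintegral_rpow_enorm_toReal (by norm_num) (by norm_num), ← ENNReal.rpow_mul]
  simp

/-- The `i`-th coefficient `F_i(λ)` of `F(z, λ) = ∑_i F_i(λ) z^i`, that is
`F_i(λ) = ∫ z^{-i} F(z, λ) dz` over the spatial circle. -/
def spatialCoeff (F : Lp ℂ 2 torusMeasure) (i : ℤ) : Lp ℂ 2 circleMeasure :=
  (memLp_spatialCoeff (Lp.memLp F) i).toLp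

theorem memLp_zMul {f : UnitAddCircle → ℂ} (hf : MemLp f 2 circleMeasure) (i : ℤ) :
    MemLp (fun x : UnitAddCircle × UnitAddCircle => (fourier i x.1 : ℂ) * f x.2) 2
      torusMeasure := by
  have h := MemLp.comp_snd hf circleMeasure
  refine h.of_le
    (((fourier i).continuous.comp continuous_fst).aestronglyMeasurable.mul h.1) ?_
  refine Filter.Eventually.of_forall fun x => ?_
  rw [norm_mul, fourier_apply, Circle.norm_coe, one_mul]

/-- The function `f(λ) z^i` on the torus. -/
def zMul (i : ℤ) (f : Lp ℂ 2 circleMeasure) : Lp ℂ 2 torusMeasure :=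
  (memLp_zMul (Lp.memLp f) i).toLp

/-- The spatio-temporal impulse response `ĝ(i, t)`: the coefficient of `z^i λ^t`. -/
def impulse (F : Lp ℂ 2 torusMeasure) (i t : ℤ) : ℂ :=
  fourierCoeff (spatialCoeff F i) t

/-! ### The Hardy space and its projections -/

/-- The Hardy space `H₂` of the temporal circle: no negative powers of `λ`. -/
def hardy : Submodule ℂ (Lp ℂ 2 circleMeasure) where
  carrier := {f | ∀ t : ℤ, t < 0 → fourierCoeff f t = 0}
  add_mem' := by
    intro f g hf hg t ht
    have h1 := hf t ht
    have h2 := hg t ht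
    rw [← fourierBasis_repr] at h1 h2 ⊢
    simp [h1, h2]
  zero_mem' := by
    intro t _
    rw [← fourierBasis_repr]
    simp
  smul_mem' := by
    intro c f hf t ht
    have h1 := hf t ht
    rw [← fourierBasis_repr] at h1 ⊢
    simp [h1]

theorem isClosed_hardy : IsClosed (hardy : Set (Lp ℂ 2 circleMeasure)) := by
  have h : (hardy : Set (Lp ℂ 2 circleMeasure)) =
      ⋂ t : ℤ, ⋂ _ : t < 0, {f | fourierBasis.repr f t = 0} := by
    ext f
    simp [hardy, fourierBasis_repr]
  rw [h]
  refine isClosed_iInter fun t => isClosed_iInter fun _ => ?_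
  exact isClosed_eq ((lp.evalCLM ℂ (fun _ : ℤ => ℂ) 2 t).continuous.comp
    fourierBasis.repr.continuous) continuous_const

instance : CompleteSpace hardy := isClosed_hardy.completeSpace_coe

/-! ### Stability, causality and the cone structure -/

/-- A stable system: a bounded multiplication operator that is temporally causal. -/
def IsStable (G : Lp ℂ ∞ torusMeasure) : Prop :=
  ∀ i t : ℤ, t < 0 → impulse (toL2 G) i t = 0

/-- `F(z, λ) = ∑_i f_i(λ) z^i` with `f_i(λ) = λ^{|i|} f̃_i(λ)` and `f̃_i ∈ H₂`. -/
def IsConeCausal (F : Lp ℂ 2 torusMeasure) : Prop :=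
  ∀ i : ℤ, ∃ f ∈ hardy, spatialCoeff F i = lambdaMul |i| f

/-- An inner function: causal, and multiplication by it is an isometry of `L²`. -/
def IsInner (U : Lp ℂ ∞ torusMeasure) : Prop :=
  IsStable U ∧ ∀ F : Lp ℂ 2 torusMeasure, ‖lmul U F‖ = ‖F‖

/-! ### Decentralized controllers

A controller need not be stable, so that it is given by its transfer function as a formal power
series in `λ` whose coefficients are Laurent polynomials in `z`. -/

/-- The series `∑_k g_k(z) λ^k` only contains `z^n λ^k` with `|n| ≤ k`. -/
def IsConeSeries (K : ℂ[T;T⁻¹]⟦X⟧) : Prop :=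
  ∀ (k : ℕ) (n : ℤ), (k : ℤ) < |n| → (PowerSeries.coeff k K).coeff n = 0

/-- The transfer function `∑_k (∑_{|n| ≤ k} ĝ(n, k) z^n) λ^k` of a cone causal system. -/
def coneSeries (F : Lp ℂ 2 torusMeasure) : ℂ[T;T⁻¹]⟦X⟧ :=
  PowerSeries.mk fun k =>
    ∑ n ∈ Finset.Icc (-(k : ℤ)) k, LaurentPolynomial.C (impulse F n k) * LaurentPolynomial.T n

/-- The cone causal transfer function `S` is that of a system `F` on the torus lying in `L^p`.
For `p = 2` this is finiteness of the `ℓ₂` norm of the impulse response, for `p = ∞` it is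
boundedness as an operator on `L²`. -/
def Realizes (p : ℝ≥0∞) (F : Lp ℂ 2 torusMeasure) (S : ℂ[T;T⁻¹]⟦X⟧) : Prop :=
  IsConeCausal F ∧ MemLp F p torusMeasure ∧ coneSeries F = S

/-- The sensitivity `(1 - G K)⁻¹` of the loop `y = G u`, `u = K y`. -/
def sensitivity (G K : ℂ[T;T⁻¹]⟦X⟧) : ℂ[T;T⁻¹]⟦X⟧ := Ring.inverse (1 - G * K)

/-- `K` internally stabilizes `G`: the loop is well posed and all the closed-loop maps
`(1 - G K)⁻¹`, `K (1 - G K)⁻¹`, `G (1 - G K)⁻¹` are stable. -/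
def IsStabilizing (p : ℝ≥0∞) (G K : ℂ[T;T⁻¹]⟦X⟧) : Prop :=
  IsUnit (1 - G * K) ∧
  (∃ F, Realizes p F (sensitivity G K)) ∧
  (∃ F, Realizes p F (K * sensitivity G K)) ∧
  (∃ F, Realizes p F (G * sensitivity G K))

/-- `K` is a stabilizing controller with the cone structure, and `c` is the norm of its closed-loop
disturbance response `T_zw = G_zw + G_zu K (1 - G_yu K)⁻¹ G_yw`. -/
def IsDecentralizedCost (p : ℝ≥0∞) (Gzw Gzu Gyw Gyu : Lp ℂ ∞ torusMeasure)
    (K : ℂ[T;T⁻¹]⟦X⟧) (c : ℝ) : Prop :=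
  IsConeSeries K ∧ IsStabilizing p (coneSeries (toL2 Gyu)) K ∧
  ∃ R, Realizes p R (K * sensitivity (coneSeries (toL2 Gyu)) K) ∧
    c = ‖toL2 Gzw + lmul (lmul Gzu Gyw) R‖

/-! ### The candidate solution

Here `D` stands for `T_{2in}^* T_1 = ∑_i T̃_i(λ) z^i`. -/

/-- `T̃_i(λ) / λ^{|i|}`. -/
def scaledCoeff (D : Lp ℂ 2 torusMeasure) (i : ℤ) : Lp ℂ 2 circleMeasure :=
  lambdaMul (-|i|) (spatialCoeff D i)

/-- `η̃_i = Π_{H₂} [T̃_i / λ^{|i|}]`. -/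
def etaTilde (D : Lp ℂ 2 torusMeasure) (i : ℤ) : Lp ℂ 2 circleMeasure :=
  hardy.starProjection (scaledCoeff D i)

/-- `‖T̃_i / λ^{|i|}‖²` in `H₂^⊥`: the squared norm of the component in the orthogonal
complement of `H₂`. -/
def residualSq (D : Lp ℂ 2 torusMeasure) (i : ℤ) : ℝ :=
  ‖hardyᗮ.starProjection (scaledCoeff D i)‖ ^ 2

/-- `Q = (∑_i λ^{|i|} η̃_i(λ) z^i) / T_{2out}`, where `V = 1 / T_{2out}`. -/
def optimalQ (V : Lp ℂ ∞ torusMeasure) (D : Lp ℂ 2 torusMeasure) : Lp ℂ 2 torusMeasure :=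
  lmul V (∑' i : ℤ, zMul i (lambdaMul |i| (etaTilde D i)))

/-- `K = -Q (1 - G Q)⁻¹`. -/
def youlaController (G Q : ℂ[T;T⁻¹]⟦X⟧) : ℂ[T;T⁻¹]⟦X⟧ := -Q * Ring.inverse (1 - G * Q)

end

/-! A multiplier that is an isometry of `L²` is unimodular, so the inner factor drops out of the
cost and leaves `‖D - T2out Q'‖` with `D` the image of `T1` under `star T2in`. A causal inverse of a
cone causal system is again cone causal (`isConeCausal_of_inverse`), hence `Q' ↦ T2out Q'` is a
bijection of the cone causal part of `L²`, and `T2out Q'` may be taken as the unknown. Parseval in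
`z` (`isHilbertSum_zMul`) then splits the cost into one independent problem for each `i`. Dividing
by the unimodular `λ^{|i|}` turns each of them into a distance to `H₂`, which orthogonal projection
solves. The projections are square-summable in `i`, so they assemble into `Q`.

The exponent `p` does not change the infimum: trigonometric polynomials supported in the cone are
bounded and `L²`-dense among cone causal systems, and the cost is continuous in the `L²` norm.

For controllers, `coneSeries_lmul` carries products of systems to products of formal series, where
the Youla substitution makes every closed-loop map polynomial in `q`. Conversely, if `R` realizes `K
(1 - G K)⁻¹`, then `-R` is a Youla parameter of the same cost. The loop of a parameter is ill posed
only when `ĝ(0,0) q̂(0,0) = 1`, which a small constant perturbation of an approximant avoids. -/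

noncomputable section

/-! ### Pointwise multiplication -/

section lmul

variable {α : Type*} [MeasurableSpace α] {μ : Measure α} {p : ℝ≥0∞}

theorem coeFn_lmul (G : Lp ℂ ∞ μ) (F : Lp ℂ p μ) :
    ⇑(lmul G F) =ᵐ[μ] fun x => G x * F x :=
  MemLp.coeFn_toLp _

theorem lmul_add (G : Lp ℂ ∞ μ) (F F' : Lp ℂ p μ) :
    lmul G (F + F') = lmul G F + lmul G F' := by
  ext1
  filter_upwards [coeFn_lmul G (F + F'), coeFn_lmul G F, coeFn_lmul G F', Lp.coeFn_add F F',
    Lp.coeFn_add (lmul G F) (lmul G F')] with x h1 h2 h3 h4 h5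
  rw [h1, h5, Pi.add_apply, h2, h3, h4, Pi.add_apply, mul_add]

theorem lmul_smul (G : Lp ℂ ∞ μ) (c : ℂ) (F : Lp ℂ p μ) :
    lmul G (c • F) = c • lmul G F := by
  ext1
  filter_upwards [coeFn_lmul G (c • F), coeFn_lmul G F, Lp.coeFn_smul c F,
    Lp.coeFn_smul c (lmul G F)] with x h1 h2 h3 h4
  simp only [h1, h2, h3, h4, Pi.smul_apply, smul_eq_mul]
  ring

theorem lmul_neg (G : Lp ℂ ∞ μ) (F : Lp ℂ p μ) : lmul G (-F) = -lmul G F := by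
  have h := lmul_smul G (-1) F
  simpa using h

theorem lmul_sub (G : Lp ℂ ∞ μ) (F F' : Lp ℂ p μ) :
    lmul G (F - F') = lmul G F - lmul G F' := by
  rw [sub_eq_add_neg, lmul_add, lmul_neg, ← sub_eq_add_neg]

theorem lmul_lmul (G H : Lp ℂ ∞ μ) (F : Lp ℂ p μ) :
    lmul G (lmul H F) = lmul (lmul G H) F := by
  ext1
  filter_upwards [coeFn_lmul G (lmul H F), coeFn_lmul H F, coeFn_lmul (lmul G H) F,
    coeFn_lmul G H] with x h1 h2 h3 h4
  rw [h1, h2, h3, h4, mul_assoc]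

theorem lmul_comm (G H : Lp ℂ ∞ μ) : lmul G H = lmul H G := by
  ext1
  filter_upwards [coeFn_lmul G H, coeFn_lmul H G] with x h1 h2
  rw [h1, h2, mul_comm]

theorem lmul_one [IsFiniteMeasure μ] (F : Lp ℂ p μ) : lmul (Lp.const ∞ μ (1 : ℂ)) F = F := by
  ext1
  filter_upwards [coeFn_lmul (Lp.const ∞ μ (1 : ℂ)) F, Lp.coeFn_const ∞ μ (1 : ℂ)] with x h1 h2
  rw [h1, h2, Function.const_apply, one_mul]

/-- Multiplication by a bounded function is a bounded operator on `L^p`. -/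
theorem norm_lmul_le [Fact (1 ≤ p)] (G : Lp ℂ ∞ μ) (F : Lp ℂ p μ) :
    ‖lmul G F‖ ≤ ‖G‖ * ‖F‖ := by
  rw [lmul, Lp.norm_toLp, Lp.norm_def, Lp.norm_def, ← ENNReal.toReal_mul]
  refine ENNReal.toReal_mono (ENNReal.mul_ne_top (Lp.eLpNorm_ne_top G) (Lp.eLpNorm_ne_top F)) ?_
  exact eLpNorm_smul_le_mul_eLpNorm (Lp.aestronglyMeasurable F) (Lp.aestronglyMeasurable G)

theorem memLp_lmul {q : ℝ≥0∞} (G : Lp ℂ ∞ μ) {F : Lp ℂ p μ} (hF : MemLp F q μ) :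
    MemLp (lmul G F) q μ :=
  (memLp_congr_ae (MemLp.coeFn_toLp _)).2 (hF.smul (Lp.memLp G))

theorem inner_lmul (G : Lp ℂ ∞ μ) (F F' : Lp ℂ 2 μ) :
    inner ℂ F (lmul G F') = inner ℂ (lmul (star G) F) F' := by
  rw [L2.inner_def, L2.inner_def]
  refine integral_congr_ae ?_
  filter_upwards [coeFn_lmul G F', coeFn_lmul (star G) F, Lp.coeFn_star G] with x h1 h2 h3
  rw [h1, h2, h3, Pi.star_apply]
  simp only [RCLike.inner_apply, map_mul, RCLike.star_def, RingHomCompTriple.comp_apply,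
    RingHom.id_apply]
  ring

/-- A multiplier which is an isometry of `L²` is unimodular. -/
theorem lmul_star_self_of_isometry [IsFiniteMeasure μ] {U : Lp ℂ ∞ μ}
    (hU : ∀ F : Lp ℂ 2 μ, ‖lmul U F‖ = ‖F‖) :
    lmul (star U) U = Lp.const ∞ μ (1 : ℂ) := by
  let L : Lp ℂ 2 μ →ₗ[ℂ] Lp ℂ 2 μ :=
    { toFun := lmul U, map_add' := lmul_add U, map_smul' := lmul_smul U }
  have hL := (LinearMap.norm_map_iff_inner_map_map L).1 hU
  -- Preservation of inner products makes multiplication by `|U|²` the identity on `L²`. Since the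
  -- measure is finite, it can be tested on the constant `1`, which gives `|U|² = 1` pointwise.
  have h1 : lmul (star U) (lmul U (Lp.const 2 μ (1 : ℂ))) = Lp.const 2 μ (1 : ℂ) := by
    refine ext_inner_left ℂ fun F => ?_
    rw [inner_lmul, star_star]
    exact hL F _
  ext1
  have h2 := coeFn_lmul (star U) (lmul U (Lp.const 2 μ (1 : ℂ)))
  rw [h1] at h2
  filter_upwards [h2, coeFn_lmul U (Lp.const 2 μ (1 : ℂ)), Lp.coeFn_const 2 μ (1 : ℂ),
    Lp.coeFn_const ∞ μ (1 : ℂ), coeFn_lmul (star U) U] with x h2 h3 h4 h5 h6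
  rw [h3, h4, Function.const_apply, mul_one] at h2
  rw [h6, h5, ← h2, Function.const_apply]

end lmul

/-! ### The circle -/

theorem fourierCoeff_eq_inner (f : Lp ℂ 2 circleMeasure) (t : ℤ) :
    fourierCoeff f t = inner ℂ (fourierLp 2 t : Lp ℂ 2 circleMeasure) f := by
  rw [← fourierBasis_repr, HilbertBasis.repr_apply_apply, coe_fourierBasis]

theorem ext_fourierCoeff {f g : Lp ℂ 2 circleMeasure}
    (h : ∀ t, fourierCoeff f t = fourierCoeff g t) : f = g := by
  refine fourierBasis.repr.injective (lp.ext (funext fun t => ?_))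
  simpa only [fourierBasis_repr] using h t

theorem coeFn_lambdaMul (n : ℤ) (f : Lp ℂ 2 circleMeasure) :
    ⇑(lambdaMul n f) =ᵐ[circleMeasure] fun w => fourier n w * f w := by
  filter_upwards [coeFn_lmul (fourierLp ∞ n) f,
    coeFn_fourierLp (T := 1) ∞ n] with w h1 h2
  rw [lambdaMul, h1, h2]

theorem fourierCoeff_lambdaMul (n : ℤ) (f : Lp ℂ 2 circleMeasure) (t : ℤ) :
    fourierCoeff (lambdaMul n f) t = fourierCoeff f (t - n) := by
  refine integral_congr_ae ?_
  filter_upwards [coeFn_lambdaMul n f] with w h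
  rw [h, smul_eq_mul, smul_eq_mul, ← mul_assoc, ← fourier_add]
  congr 3
  ring

theorem lambdaMul_lambdaMul (n m : ℤ) (f : Lp ℂ 2 circleMeasure) :
    lambdaMul n (lambdaMul m f) = lambdaMul (n + m) f :=
  ext_fourierCoeff fun t => by
    simp only [fourierCoeff_lambdaMul]
    congr 1
    ring

theorem lambdaMul_zero (f : Lp ℂ 2 circleMeasure) : lambdaMul 0 f = f :=
  ext_fourierCoeff fun t => by rw [fourierCoeff_lambdaMul, sub_zero]

theorem lambdaMul_sub (n : ℤ) (f g : Lp ℂ 2 circleMeasure) :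
    lambdaMul n (f - g) = lambdaMul n f - lambdaMul n g :=
  lmul_sub _ f g

theorem norm_lambdaMul (n : ℤ) (f : Lp ℂ 2 circleMeasure) : ‖lambdaMul n f‖ = ‖f‖ := by
  rw [Lp.norm_def, Lp.norm_def]
  congr 1
  refine eLpNorm_congr_norm_ae ?_
  filter_upwards [coeFn_lambdaMul n f] with w h
  rw [h, norm_mul, fourier_apply, Circle.norm_coe, one_mul]

/-! ### The spatial expansion -/

theorem coeFn_zMul (i : ℤ) (f : Lp ℂ 2 circleMeasure) :
    ⇑(zMul i f) =ᵐ[torusMeasure] fun x => fourier i x.1 * f x.2 :=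
  MemLp.coeFn_toLp _

theorem coeFn_spatialCoeff (F : Lp ℂ 2 torusMeasure) (i : ℤ) :
    ⇑(spatialCoeff F i) =ᵐ[circleMeasure] fun w => fourierCoeff (fun θ => F (θ, w)) i :=
  MemLp.coeFn_toLp _

theorem quasiMeasurePreserving_snd_torus :
    Measure.QuasiMeasurePreserving (Prod.snd : UnitAddCircle × UnitAddCircle → UnitAddCircle)
      torusMeasure circleMeasure :=
  Measure.quasiMeasurePreserving_snd

/-- By Fubini, `spatialCoeff · i` is the adjoint of `zMul i`. Most later facts about coefficients
follow from this adjunction rather than from almost-everywhere computations. -/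
theorem inner_zMul_left (i : ℤ) (f : Lp ℂ 2 circleMeasure) (F : Lp ℂ 2 torusMeasure) :
    inner ℂ (zMul i f) F = inner ℂ f (spatialCoeff F i) := by
  have hint := L2.integrable_inner (𝕜 := ℂ) (zMul i f) F
  have heq : (fun x => inner ℂ (zMul i f x) (F x)) =ᵐ[torusMeasure]
      fun x => inner ℂ (f x.2) ((fourier (-i) x.1 : ℂ) • F x) := by
    filter_upwards [coeFn_zMul i f] with x hx
    rw [hx]
    simp only [RCLike.inner_apply, map_mul, fourier_neg, smul_eq_mul]
    ring
  rw [L2.inner_def, L2.inner_def, integral_congr_ae heq,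
    integral_prod_symm _ (hint.congr heq)]
  refine integral_congr_ae ?_
  filter_upwards [coeFn_spatialCoeff F i] with w hw
  rw [hw, fourierCoeff]
  simp only [RCLike.inner_apply]
  rw [← integral_mul_const]

theorem inner_zMul_zMul (i j : ℤ) (f g : Lp ℂ 2 circleMeasure) :
    inner ℂ (zMul i f) (zMul j g) = if i = j then inner ℂ f g else 0 := by
  have heq : (fun x => inner ℂ (zMul i f x) (zMul j g x)) =ᵐ[torusMeasure]
      fun x => ((fourier (-i) x.1 : ℂ) • fourier j x.1) * inner ℂ (f x.2) (g x.2) := by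
    filter_upwards [coeFn_zMul i f, coeFn_zMul j g] with x hx hy
    rw [hx, hy]
    simp only [RCLike.inner_apply, map_mul, fourier_neg, smul_eq_mul]
    ring
  rw [L2.inner_def, L2.inner_def, integral_congr_ae heq,
    integral_prod_mul (fun θ : UnitAddCircle => (fourier (-i) θ : ℂ) • fourier j θ)
      (fun w => inner ℂ (f w) (g w))]
  have h : (∫ θ : UnitAddCircle, (fourier (-i) θ : ℂ) • (fourier j θ : ℂ) ∂circleMeasure)
      = fourierCoeff (fourier j : UnitAddCircle → ℂ) i := rfl
  rw [h, fourierCoeff_fourier, Pi.single_apply]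
  split_ifs <;> simp

/-- `f ↦ f(λ) z^i` as an isometric embedding. -/
def zMulₗᵢ (i : ℤ) : Lp ℂ 2 circleMeasure →ₗᵢ[ℂ] Lp ℂ 2 torusMeasure :=
  LinearMap.isometryOfInner
    { toFun := zMul i
      map_add' := fun f g => by
        ext1
        filter_upwards [coeFn_zMul i (f + g), coeFn_zMul i f, coeFn_zMul i g,
          Lp.coeFn_add (zMul i f) (zMul i g),
          quasiMeasurePreserving_snd_torus.ae (Lp.coeFn_add f g)] with x h1 h2 h3 h4 h5
        rw [h1, h4, Pi.add_apply, h2, h3, h5, Pi.add_apply, mul_add]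
      map_smul' := fun c f => by
        ext1
        filter_upwards [coeFn_zMul i (c • f), coeFn_zMul i f,
          Lp.coeFn_smul c (zMul i f),
          quasiMeasurePreserving_snd_torus.ae (Lp.coeFn_smul c f)] with x h1 h2 h3 h4
        rw [h1, RingHom.id_apply, h3, Pi.smul_apply, h2, h4, Pi.smul_apply, smul_eq_mul,
          smul_eq_mul]
        ring }
    fun f g => by simpa using inner_zMul_zMul i i f g

@[simp]
theorem zMulₗᵢ_apply (i : ℤ) (f : Lp ℂ 2 circleMeasure) : zMulₗᵢ i f = zMul i f := rfl

theorem orthogonalFamily_zMul :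
    OrthogonalFamily ℂ (fun _ : ℤ => Lp ℂ 2 circleMeasure) zMulₗᵢ := by
  intro i j hij f g
  simp [inner_zMul_zMul, hij]

/-- Completeness in two variables reduces to one: almost every slice in `θ` is in `L²` with all its
Fourier coefficients zero, hence vanishes, and Fubini gives norm zero. The exceptional null set is
common to all `i` because there are countably many. -/
theorem eq_zero_of_spatialCoeff {F : Lp ℂ 2 torusMeasure} (h : ∀ i, spatialCoeff F i = 0) :
    F = 0 := by
  have hsq : Integrable (fun x => ‖F x‖ ^ 2) torusMeasure :=
    (Lp.memLp F).integrable_norm_pow two_ne_zero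
  have hmeas : ∀ᵐ w ∂circleMeasure, AEStronglyMeasurable (fun θ => F (θ, w)) circleMeasure :=
    (Lp.aestronglyMeasurable F).prod_swap.prodMk_left
  have hcoeff : ∀ᵐ w ∂circleMeasure, ∀ i, fourierCoeff (fun θ => F (θ, w)) i = 0 := by
    rw [ae_all_iff]
    intro i
    have h0 := coeFn_spatialCoeff F i
    rw [h i] at h0
    filter_upwards [h0, Lp.coeFn_zero ℂ 2 circleMeasure] with w hw hz
    rw [← hw, hz, Pi.zero_apply]
  have hslice : ∀ᵐ w ∂circleMeasure, ∫ θ, ‖F (θ, w)‖ ^ 2 ∂circleMeasure = 0 := by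
    filter_upwards [hmeas, hcoeff, hsq.prod_left_ae] with w hw hc hi
    have hmem : MemLp (fun θ => F (θ, w)) 2 circleMeasure :=
      (memLp_two_iff_integrable_sq_norm hw).2 hi
    have h0 : hmem.toLp = 0 := by
      refine ext_fourierCoeff fun t => ?_
      rw [fourierCoeff_congr_ae hmem.coeFn_toLp, hc t, fourierCoeff_eq_inner, inner_zero_right]
    have hae := hmem.coeFn_toLp
    rw [h0] at hae
    rw [integral_eq_zero_iff_of_nonneg (fun _ => by positivity) hi]
    filter_upwards [hae, Lp.coeFn_zero ℂ 2 circleMeasure] with θ h1 h2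
    rw [← h1, h2]
    simp
  have htot : ∫ x, ‖F x‖ ^ 2 ∂torusMeasure = 0 := by
    rw [integral_prod_symm _ hsq, integral_congr_ae hslice, integral_zero]
  rw [integral_eq_zero_iff_of_nonneg (fun _ => by positivity) hsq] at htot
  rw [Lp.eq_zero_iff_ae_eq_zero]
  filter_upwards [htot] with x hx
  simpa using hx

theorem isHilbertSum_zMul : IsHilbertSum ℂ (fun _ : ℤ => Lp ℂ 2 circleMeasure) zMulₗᵢ := by
  refine IsHilbertSum.mk orthogonalFamily_zMul ?_
  rw [top_le_iff, Submodule.topologicalClosure_eq_top_iff, Submodule.eq_bot_iff]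
  intro F hF
  refine eq_zero_of_spatialCoeff fun i => ext_inner_left ℂ fun f => ?_
  rw [← inner_zMul_left, inner_zero_right]
  exact Submodule.inner_right_of_mem_orthogonal
    (Submodule.mem_iSup_of_mem i (LinearMap.mem_range_self _ f)) hF

/-- Identifying the integral formula with the Hilbert-sum coordinate yields linearity,
reconstruction and Parseval for `spatialCoeff`. -/
theorem spatialCoeff_eq_linearIsometryEquiv (F : Lp ℂ 2 torusMeasure) (i : ℤ) :
    spatialCoeff F i = isHilbertSum_zMul.linearIsometryEquiv F i := by
  classical
  refine ext_inner_left ℂ fun f => ?_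
  rw [← inner_zMul_left, ← lp.inner_single_left (𝕜 := ℂ) (G := fun _ : ℤ => Lp ℂ 2 circleMeasure),
    ← isHilbertSum_zMul.linearIsometryEquiv.symm.inner_map_map,
    IsHilbertSum.linearIsometryEquiv_symm_apply_single, LinearIsometryEquiv.symm_apply_apply,
    zMulₗᵢ_apply]

theorem hasSum_zMul_spatialCoeff (F : Lp ℂ 2 torusMeasure) :
    HasSum (fun i : ℤ => zMul i (spatialCoeff F i)) F := by
  have h := isHilbertSum_zMul.hasSum_linearIsometryEquiv_symm
    (isHilbertSum_zMul.linearIsometryEquiv F)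
  rw [LinearIsometryEquiv.symm_apply_apply] at h
  simpa only [spatialCoeff_eq_linearIsometryEquiv, zMulₗᵢ_apply] using h

theorem hasSum_norm_sq_spatialCoeff (F : Lp ℂ 2 torusMeasure) :
    HasSum (fun i => ‖spatialCoeff F i‖ ^ 2) (‖F‖ ^ 2) := by
  have h := lp.hasSum_norm (p := 2) (by norm_num) (isHilbertSum_zMul.linearIsometryEquiv F)
  rw [LinearIsometryEquiv.norm_map] at h
  simpa [spatialCoeff_eq_linearIsometryEquiv] using h

theorem summable_zMul_iff {h : ℤ → Lp ℂ 2 circleMeasure} :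
    Summable (fun i => zMul i (h i)) ↔ Summable fun i => ‖h i‖ ^ 2 :=
  orthogonalFamily_zMul.summable_iff_norm_sq_summable h

theorem spatialCoeff_sub (F F' : Lp ℂ 2 torusMeasure) (i : ℤ) :
    spatialCoeff (F - F') i = spatialCoeff F i - spatialCoeff F' i := by
  simp [spatialCoeff_eq_linearIsometryEquiv]

theorem spatialCoeff_of_hasSum {h : ℤ → Lp ℂ 2 circleMeasure} {F : Lp ℂ 2 torusMeasure}
    (hF : HasSum (fun i => zMul i (h i)) F) (i : ℤ) : spatialCoeff F i = h i := by
  refine ext_inner_left ℂ fun f => ?_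
  rw [← inner_zMul_left]
  have h1 := hF.mapL (innerSL ℂ (zMul i f))
  simp only [innerSL_apply_apply, inner_zMul_zMul] at h1
  have h2 : (fun j => if i = j then inner ℂ f (h j) else 0) =
      fun j => if j = i then inner ℂ f (h i) else 0 := by
    funext j
    by_cases hij : i = j
    · subst hij
      simp
    · simp [hij, Ne.symm hij]
  rw [h2] at h1
  exact h1.unique (hasSum_ite_eq i _)

/-! ### The impulse response -/

/-- The monomial `z^i λ^t`. -/
def monomialL2 (x : ℤ × ℤ) : Lp ℂ 2 torusMeasure := zMul x.1 (fourierLp 2 x.2)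

theorem impulse_eq_inner (F : Lp ℂ 2 torusMeasure) (i t : ℤ) :
    impulse F i t = inner ℂ (monomialL2 (i, t)) F := by
  rw [impulse, fourierCoeff_eq_inner, monomialL2, inner_zMul_left]

theorem orthonormal_monomialL2 : Orthonormal ℂ monomialL2 := by
  classical
  rw [orthonormal_iff_ite]
  rintro ⟨i, t⟩ ⟨j, s⟩
  have h := (orthonormal_iff_ite.1 (orthonormal_fourier (T := 1))) t s
  rw [monomialL2, monomialL2, inner_zMul_zMul]
  simp only [h, Prod.mk.injEq]
  split_ifs <;> tauto

/-- The monomials `z^i λ^t` form a Hilbert basis of `L²` of the torus. -/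
def monomialBasis : HilbertBasis (ℤ × ℤ) ℂ (Lp ℂ 2 torusMeasure) :=
  HilbertBasis.mkOfOrthogonalEqBot orthonormal_monomialL2 <| by
    rw [Submodule.eq_bot_iff]
    intro F hF
    refine eq_zero_of_spatialCoeff fun i => ext_fourierCoeff fun t => ?_
    rw [fourierCoeff_eq_inner _ t, fourierCoeff_eq_inner _ t, inner_zero_right,
      ← inner_zMul_left]
    exact Submodule.inner_right_of_mem_orthogonal
      (Submodule.subset_span (Set.mem_range_self (i, t))) hF

@[simp]
theorem coe_monomialBasis : ⇑monomialBasis = monomialL2 :=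
  HilbertBasis.coe_mkOfOrthogonalEqBot _ _

theorem hasSum_impulse_smul_monomialL2 (F : Lp ℂ 2 torusMeasure) :
    HasSum (fun x : ℤ × ℤ => impulse F x.1 x.2 • monomialL2 x) F := by
  have h := monomialBasis.hasSum_repr F
  simpa only [HilbertBasis.repr_apply_apply, coe_monomialBasis, impulse_eq_inner] using h

theorem impulse_add (F F' : Lp ℂ 2 torusMeasure) (i t : ℤ) :
    impulse (F + F') i t = impulse F i t + impulse F' i t := by
  simp only [impulse_eq_inner, inner_add_right]

theorem impulse_sub (F F' : Lp ℂ 2 torusMeasure) (i t : ℤ) :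
    impulse (F - F') i t = impulse F i t - impulse F' i t := by
  simp only [impulse_eq_inner, inner_sub_right]

theorem impulse_neg (F : Lp ℂ 2 torusMeasure) (i t : ℤ) :
    impulse (-F) i t = -impulse F i t := by
  simp only [impulse_eq_inner, inner_neg_right]

theorem impulse_smul (c : ℂ) (F : Lp ℂ 2 torusMeasure) (i t : ℤ) :
    impulse (c • F) i t = c * impulse F i t := by
  simp only [impulse_eq_inner, inner_smul_right]

theorem impulse_monomialL2 (x : ℤ × ℤ) (i t : ℤ) :
    impulse (monomialL2 x) i t = if (i, t) = x then 1 else 0 := by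
  classical
  rw [impulse_eq_inner, (orthonormal_iff_ite.1 orthonormal_monomialL2)]

theorem coeFn_monomialL2 (x : ℤ × ℤ) :
    ⇑(monomialL2 x) =ᵐ[torusMeasure] fun y => fourier x.1 y.1 * fourier x.2 y.2 := by
  filter_upwards [coeFn_zMul x.1 (fourierLp 2 x.2 : Lp ℂ 2 circleMeasure),
    quasiMeasurePreserving_snd_torus.ae (coeFn_fourierLp (T := 1) 2 x.2)] with y h1 h2
  rw [monomialL2, h1, h2]

theorem coeFn_toL2 (G : Lp ℂ ∞ torusMeasure) : ⇑(toL2 G) =ᵐ[torusMeasure] G :=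
  MemLp.coeFn_toLp _

theorem toL2_lmul (G H : Lp ℂ ∞ torusMeasure) : toL2 (lmul G H) = lmul G (toL2 H) := by
  ext1
  filter_upwards [coeFn_toL2 (lmul G H), coeFn_lmul G H, coeFn_lmul G (toL2 H),
    coeFn_toL2 H] with x h1 h2 h3 h4
  rw [h1, h2, h3, h4]

theorem toL2_one : toL2 (Lp.const ∞ torusMeasure (1 : ℂ)) = monomialL2 0 := by
  ext1
  filter_upwards [coeFn_toL2 (Lp.const ∞ torusMeasure (1 : ℂ)), coeFn_monomialL2 0,
    Lp.coeFn_const ∞ torusMeasure (1 : ℂ)] with x h1 h2 h3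
  rw [h1, h2, h3]
  simp

/-- The impulse response of a product is the convolution of the impulse responses. -/
theorem hasSum_impulse_lmul (G : Lp ℂ ∞ torusMeasure) (F : Lp ℂ 2 torusMeasure) (i t : ℤ) :
    HasSum (fun x : ℤ × ℤ => impulse (toL2 G) (i - x.1) (t - x.2) * impulse F x.1 x.2)
      (impulse (lmul G F) i t) := by
  -- Moving `G` across the inner product and applying Parseval gives the convolution sum, with
  -- convergence included. Each factor involving `G` is a shifted impulse value because monomials
  -- multiply by adding exponents.
  have h := monomialBasis.hasSum_inner_mul_inner (lmul (star G) (monomialL2 (i, t))) F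
  rw [← inner_lmul, ← impulse_eq_inner] at h
  refine h.congr_fun fun x => ?_
  obtain ⟨j, s⟩ := x
  rw [coe_monomialBasis, ← impulse_eq_inner, ← inner_lmul, impulse_eq_inner (toL2 G),
    L2.inner_def, L2.inner_def]
  congr 1
  refine integral_congr_ae ?_
  filter_upwards [coeFn_lmul G (monomialL2 (j, s)), coeFn_monomialL2 (j, s),
    coeFn_monomialL2 (i, t), coeFn_monomialL2 (i - j, t - s), coeFn_toL2 G] with x h1 h2 h3 h4 h5
  rw [h1, h2, h3, h4, h5]
  simp only [RCLike.inner_apply, map_mul, ← fourier_neg, neg_sub, sub_eq_add_neg j, sub_eq_add_neg s,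
    fourier_add]
  ring

/-! ### Cone causality -/

/-- Multiplication by `λ^{|i|}` is invertible, so `f̃_i` is determined and its membership in `H₂` is
a support condition. Cone causality thus becomes support of the impulse response in the cone `|i| ≤
t`. -/
theorem isConeCausal_iff {F : Lp ℂ 2 torusMeasure} :
    IsConeCausal F ↔ ∀ i t : ℤ, t < |i| → impulse F i t = 0 := by
  constructor
  · intro h i t ht
    obtain ⟨f, hf, hfi⟩ := h i
    rw [impulse, hfi, fourierCoeff_lambdaMul]
    exact hf _ (by omega)
  · intro h i
    refine ⟨lambdaMul (-|i|) (spatialCoeff F i), fun t ht => ?_, ?_⟩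
    · rw [fourierCoeff_lambdaMul]
      exact h i _ (by omega)
    · rw [lambdaMul_lambdaMul, add_neg_cancel, lambdaMul_zero]

/-- The cone causal elements of `L²` as a subspace. -/
def coneCausal : Submodule ℂ (Lp ℂ 2 torusMeasure) where
  carrier := {F | IsConeCausal F}
  add_mem' {F F'} hF hF' := isConeCausal_iff.2 fun i t h => by
    rw [impulse_add, isConeCausal_iff.1 hF i t h, isConeCausal_iff.1 hF' i t h, add_zero]
  zero_mem' := isConeCausal_iff.2 fun i t _ => by rw [impulse_eq_inner, inner_zero_right]
  smul_mem' c F hF := isConeCausal_iff.2 fun i t h => by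
    rw [impulse_smul, isConeCausal_iff.1 hF i t h, mul_zero]

theorem isConeCausal_monomialL2 {x : ℤ × ℤ} (hx : |x.1| ≤ x.2) : IsConeCausal (monomialL2 x) := by
  refine isConeCausal_iff.2 fun i t h => ?_
  rw [impulse_monomialL2, if_neg]
  rintro rfl
  exact absurd h (not_lt.2 hx)

/-- If `G` is causal and `F` is cone causal, the convolution is a finite sum. -/
theorem impulse_lmul_eq_sum {G : Lp ℂ ∞ torusMeasure} {F : Lp ℂ 2 torusMeasure}
    (hG : IsStable G) (hF : IsConeCausal F) (i t : ℤ) :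
    impulse (lmul G F) i t = ∑ x ∈ Finset.Icc (-t) t ×ˢ Finset.Icc 0 t,
      impulse (toL2 G) (i - x.1) (t - x.2) * impulse F x.1 x.2 := by
  -- A nonzero term at `(j, s)` needs `|j| ≤ s` for `F` and `s ≤ t` for `G`, which confines it to
  -- the box.
  refine (hasSum_impulse_lmul G F i t).unique (hasSum_sum_of_ne_finset_zero fun x hx => ?_)
  by_cases h : x.2 < |x.1|
  · rw [isConeCausal_iff.1 hF _ _ h, mul_zero]
  by_cases h' : t < x.2
  · rw [hG _ _ (by omega), zero_mul]
  refine absurd ?_ hx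
  rw [Finset.mem_product, Finset.mem_Icc, Finset.mem_Icc]
  have := abs_nonneg x.1
  have := neg_abs_le x.1
  have := le_abs_self x.1
  omega

theorem isStable_of_isConeCausal {G : Lp ℂ ∞ torusMeasure} (hG : IsConeCausal (toL2 G)) :
    IsStable G :=
  fun i t ht => isConeCausal_iff.1 hG i t (ht.trans_le (abs_nonneg i))

/-- By the triangle inequality the cone is closed under addition, so convolution preserves support
in it. -/
theorem IsConeCausal.lmul {G : Lp ℂ ∞ torusMeasure} {F : Lp ℂ 2 torusMeasure}
    (hG : IsConeCausal (toL2 G)) (hF : IsConeCausal F) : IsConeCausal (lmul G F) := by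
  refine isConeCausal_iff.2 fun i t ht => ?_
  rw [impulse_lmul_eq_sum (isStable_of_isConeCausal hG) hF]
  refine Finset.sum_eq_zero fun x _ => ?_
  by_cases h : x.2 < |x.1|
  · rw [isConeCausal_iff.1 hF _ _ h, mul_zero]
  · rw [isConeCausal_iff.1 hG, zero_mul]
    have := abs_sub_abs_le_abs_sub i x.1
    omega

/-- A causal inverse of a cone causal system is cone causal. -/
theorem isConeCausal_of_inverse {G V : Lp ℂ ∞ torusMeasure} (hG : IsConeCausal (toL2 G))
    (hV : IsStable V) (h : lmul G V = Lp.const ∞ torusMeasure (1 : ℂ)) :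
    IsConeCausal (toL2 V) := by
  have hconv : ∀ i t, (∑ x ∈ Finset.Icc (-t) t ×ˢ Finset.Icc 0 t,
      impulse (toL2 V) (i - x.1) (t - x.2) * impulse (toL2 G) x.1 x.2)
        = if (i, t) = (0 : ℤ × ℤ) then 1 else 0 := fun i t => by
    rw [← impulse_lmul_eq_sum hV hG, ← toL2_lmul, lmul_comm, h, toL2_one, impulse_monomialL2]
  -- At `t = 0` the box is a single point, so the convolution identity reads `v̂(0,0) ĝ(0,0) = 1`.
  have h00 : impulse (toL2 G) 0 0 ≠ 0 := by
    intro h0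
    have := hconv 0 0
    simp [h0] at this
  have key : ∀ n : ℕ, ∀ i : ℤ, (n : ℤ) < |i| → impulse (toL2 V) i n = 0 := by
    intro n
    induction n using Nat.strong_induction_on with
    | _ n ih =>
      intro i hi
      have hc := hconv i n
      -- Outside the cone only the term at `(0, 0)` can survive. Any other `(j, s)` with `|j| ≤ s`
      -- has `s > 0`, and then `(i - j, n - s)` is again outside the cone at an earlier time, where
      -- induction applies.
      rw [Finset.sum_eq_single (0, 0), if_neg] at hc
      · simpa [h00] using hc
      · intro h0
        rw [Prod.mk_eq_zero] at h0
        rw [h0.1, abs_zero] at hi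
        omega
      · rintro ⟨j, s⟩ hx hne
        simp only [Finset.mem_product, Finset.mem_Icc] at hx
        by_cases hs : s < |j|
        · rw [isConeCausal_iff.1 hG _ _ hs, mul_zero]
        have hs0 : s ≠ 0 := by
          rintro rfl
          have : j = 0 := abs_eq_zero.1 (le_antisymm (not_lt.1 hs) (abs_nonneg j))
          exact hne (by rw [this])
        have hcast : (((n : ℤ) - s).toNat : ℤ) = n - s := Int.toNat_of_nonneg (by omega)
        have h1 := ih ((n : ℤ) - s).toNat (by omega) (i - j) (by
          have := abs_sub_abs_le_abs_sub i j
          omega)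
        rw [hcast] at h1
        rw [h1, zero_mul]
      · intro hx
        refine absurd ?_ hx
        simp
  refine isConeCausal_iff.2 fun i t ht => ?_
  by_cases h0 : t < 0
  · exact hV i t h0
  · lift t to ℕ using not_lt.1 h0
    exact key t i ht

/-! ### The formal series of a cone causal system -/

/-- The truncation `|n| ≤ k` built into `coneSeries` discards only zeros. -/
theorem coeff_coneSeries {F : Lp ℂ 2 torusMeasure} (hF : IsConeCausal F) (k : ℕ) (n : ℤ) :
    (PowerSeries.coeff k (coneSeries F)).coeff n = impulse F n k := by
  rw [coneSeries, PowerSeries.coeff_mk, AddMonoidAlgebra.coeff_sum, Finset.sum_apply']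
  simp only [← LaurentPolynomial.single_eq_C_mul_T, AddMonoidAlgebra.coeff_single,
    Finsupp.single_apply, Finset.sum_ite_eq', Finset.mem_Icc]
  split_ifs with h
  · rfl
  · refine (isConeCausal_iff.1 hF n k ?_).symm
    by_contra h'
    exact h (abs_le.1 (not_lt.1 h'))

theorem ext_coneSeries {S S' : ℂ[T;T⁻¹]⟦X⟧}
    (h : ∀ k n, (PowerSeries.coeff k S).coeff n = (PowerSeries.coeff k S').coeff n) : S = S' :=
  PowerSeries.ext fun k => LaurentPolynomial.ext fun n => h k n

theorem coneSeries_monomialL2_zero : coneSeries (monomialL2 0) = 1 := by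
  refine ext_coneSeries fun k n => ?_
  rw [coeff_coneSeries (isConeCausal_monomialL2 (by simp)), impulse_monomialL2,
    PowerSeries.coeff_one]
  by_cases hk : k = 0
  · rw [if_pos hk, ← LaurentPolynomial.T_zero, LaurentPolynomial.T_apply]
    refine if_congr ?_ rfl rfl
    rw [Prod.mk_eq_zero, hk, Nat.cast_zero, eq_comm (a := n)]
    simp
  · rw [if_neg hk, if_neg (by simp [hk])]
    rfl

theorem coneSeries_sub {F F' : Lp ℂ 2 torusMeasure} (hF : IsConeCausal F)
    (hF' : IsConeCausal F') : coneSeries (F - F') = coneSeries F - coneSeries F' := by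
  refine ext_coneSeries fun k n => ?_
  rw [coeff_coneSeries (coneCausal.sub_mem hF hF'), map_sub, AddMonoidAlgebra.coeff_sub,
    Finsupp.sub_apply, coeff_coneSeries hF, coeff_coneSeries hF', impulse_sub]

theorem coneSeries_neg {F : Lp ℂ 2 torusMeasure} (hF : IsConeCausal F) :
    coneSeries (-F) = -coneSeries F := by
  refine ext_coneSeries fun k n => ?_
  rw [coeff_coneSeries (coneCausal.neg_mem hF), map_neg, AddMonoidAlgebra.coeff_neg,
    Finsupp.neg_apply, coeff_coneSeries hF, impulse_neg]

theorem isConeSeries_coneSeries {F : Lp ℂ 2 torusMeasure} (hF : IsConeCausal F) :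
    IsConeSeries (coneSeries F) :=
  fun k n h => by rw [coeff_coneSeries hF, isConeCausal_iff.1 hF _ _ h]

/-- The coefficients of a product of Laurent polynomials, the second one supported in `s`. -/
theorem coeff_mul_eq_sum_of_support (f g : ℂ[T;T⁻¹]) (s : Finset ℤ)
    (hg : ∀ j ∉ s, g.coeff j = 0) (n : ℤ) :
    (f * g).coeff n = ∑ j ∈ s, f.coeff (n - j) * g.coeff j := by
  have hgs : g = ∑ j ∈ s, AddMonoidAlgebra.single j (g.coeff j) := by
    refine LaurentPolynomial.ext fun j => ?_
    rw [AddMonoidAlgebra.coeff_sum, Finset.sum_apply']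
    simp only [AddMonoidAlgebra.coeff_single, Finsupp.single_apply, Finset.sum_ite_eq']
    split_ifs with h
    · rfl
    · exact hg j h
  conv_lhs => rw [hgs]
  rw [Finset.mul_sum, AddMonoidAlgebra.coeff_sum, Finset.sum_apply']
  refine Finset.sum_congr rfl fun j _ => ?_
  rw [AddMonoidAlgebra.coeff_mul_single_apply, sub_eq_add_neg]

/-- Both sides are the same finite convolution, the antidiagonal of `k` being indexed by the time
`s` of the second factor. Loop algebra can therefore be done with formal series and transported to
functions on the torus. -/
theorem coneSeries_lmul {G : Lp ℂ ∞ torusMeasure} {F : Lp ℂ 2 torusMeasure}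
    (hG : IsConeCausal (toL2 G)) (hF : IsConeCausal F) :
    coneSeries (lmul G F) = coneSeries (toL2 G) * coneSeries F := by
  refine ext_coneSeries fun k n => ?_
  rw [coeff_coneSeries (hG.lmul hF), impulse_lmul_eq_sum (isStable_of_isConeCausal hG) hF,
    PowerSeries.coeff_mul, AddMonoidAlgebra.coeff_sum, Finset.sum_apply', Finset.sum_product_right]
  symm
  refine Finset.sum_bij (fun x _ => (x.2 : ℤ)) ?_ ?_ ?_ ?_
  · intro x hx
    rw [Finset.HasAntidiagonal.mem_antidiagonal] at hx
    rw [Finset.mem_Icc]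
    omega
  · intro x hx y hy hxy
    rw [Finset.HasAntidiagonal.mem_antidiagonal] at hx hy
    ext <;> omega
  · intro s hs
    rw [Finset.mem_Icc] at hs
    refine ⟨(k - s.toNat, s.toNat), ?_, ?_⟩
    · rw [Finset.HasAntidiagonal.mem_antidiagonal]
      omega
    · exact Int.toNat_of_nonneg hs.1
  · intro x hx
    rw [Finset.HasAntidiagonal.mem_antidiagonal] at hx
    rw [coeff_mul_eq_sum_of_support _ _ (Finset.Icc (-(k : ℤ)) k)]
    · refine Finset.sum_congr rfl fun j _ => ?_
      rw [coeff_coneSeries hG, coeff_coneSeries hF]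
      congr 2
      omega
    · intro j hj
      refine isConeSeries_coneSeries hF _ _ ?_
      by_contra h'
      have := abs_le.1 (not_lt.1 h')
      exact hj (Finset.mem_Icc.2 (by omega))

theorem IsConeSeries.mul {S S' : ℂ[T;T⁻¹]⟦X⟧} (hS : IsConeSeries S) (hS' : IsConeSeries S') :
    IsConeSeries (S * S') := by
  intro k n hn
  rw [PowerSeries.coeff_mul, AddMonoidAlgebra.coeff_sum, Finset.sum_apply']
  refine Finset.sum_eq_zero fun x hx => ?_
  rw [Finset.HasAntidiagonal.mem_antidiagonal] at hx
  rw [coeff_mul_eq_sum_of_support _ _ (Finset.Icc (-(x.2 : ℤ)) x.2)]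
  · refine Finset.sum_eq_zero fun j hj => ?_
    rw [hS, zero_mul]
    have := abs_sub_abs_le_abs_sub n j
    have := abs_le.2 (Finset.mem_Icc.1 hj)
    omega
  · intro j hj
    refine hS' _ _ ?_
    by_contra h'
    exact hj (Finset.mem_Icc.2 (abs_le.1 (not_lt.1 h')))

theorem IsConeSeries.one : IsConeSeries 1 := by
  rw [← coneSeries_monomialL2_zero]
  exact isConeSeries_coneSeries (isConeCausal_monomialL2 (by simp))

theorem IsConeSeries.neg {S : ℂ[T;T⁻¹]⟦X⟧} (hS : IsConeSeries S) : IsConeSeries (-S) :=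
  fun k n h => by rw [map_neg, AddMonoidAlgebra.coeff_neg, Finsupp.neg_apply, hS k n h, neg_zero]

theorem IsConeSeries.coeff_zero {S : ℂ[T;T⁻¹]⟦X⟧} (hS : IsConeSeries S) :
    PowerSeries.coeff 0 S = LaurentPolynomial.C ((PowerSeries.coeff 0 S).coeff 0) := by
  refine LaurentPolynomial.ext fun n => ?_
  rw [LaurentPolynomial.C_apply]
  split_ifs with h
  · rw [h]
  · exact hS 0 n (by simpa using h)

/-- A cone series is invertible as soon as its leading coefficient does not vanish. -/
theorem IsConeSeries.isUnit_iff {S : ℂ[T;T⁻¹]⟦X⟧} (hS : IsConeSeries S) :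
    IsUnit S ↔ (PowerSeries.coeff 0 S).coeff 0 ≠ 0 := by
  rw [PowerSeries.isUnit_iff_constantCoeff, ← PowerSeries.coeff_zero_eq_constantCoeff_apply,
    hS.coeff_zero]
  constructor
  · intro h h0
    rw [LaurentPolynomial.C_apply, if_pos rfl] at h0
    rw [h0, map_zero] at h
    exact not_isUnit_zero h
  · intro h
    rw [LaurentPolynomial.C_apply, if_pos rfl] at h
    exact (isUnit_iff_ne_zero.2 h).map LaurentPolynomial.C

/-- Induction on the power `k` of `λ`: outside the cone, the coefficient of `S⁻¹ S = 1` reduces to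
the coefficient of `S⁻¹` times the nonzero scalar leading coefficient of `S`. A non-unit has
`Ring.inverse` equal to `0`, which has the cone structure trivially. -/
theorem IsConeSeries.inverse {S : ℂ[T;T⁻¹]⟦X⟧} (hS : IsConeSeries S) :
    IsConeSeries (Ring.inverse S) := by
  by_cases hu : IsUnit S
  swap
  · rw [Ring.inverse_non_unit _ hu]
    intro k n _
    rw [map_zero]
    rfl
  have h0 := hS.isUnit_iff.1 hu
  have hmul := Ring.inverse_mul_cancel S hu
  intro k
  induction k using Nat.strong_induction_on with
  | _ k ih =>
    intro n hn
    have hc : (PowerSeries.coeff k (Ring.inverse S * S)).coeff n = 0 := by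
      rw [hmul]
      exact IsConeSeries.one k n hn
    rw [PowerSeries.coeff_mul, AddMonoidAlgebra.coeff_sum, Finset.sum_apply',
      Finset.sum_eq_single (k, 0)] at hc
    · rw [coeff_mul_eq_sum_of_support _ _ {0}, Finset.sum_singleton, sub_zero] at hc
      · exact (mul_eq_zero.1 hc).resolve_right h0
      · intro j hj
        exact hS 0 j (by simpa using hj)
    · rintro ⟨a, b⟩ hx hne
      rw [Finset.HasAntidiagonal.mem_antidiagonal] at hx
      have hak : a < k := by
        refine lt_of_le_of_ne (by omega) ?_
        rintro rfl
        exact hne (by rw [Prod.mk.injEq]; omega)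
      rw [coeff_mul_eq_sum_of_support _ _ (Finset.Icc (-(b : ℤ)) b)]
      · refine Finset.sum_eq_zero fun j hj => ?_
        rw [ih a hak, zero_mul]
        have := abs_sub_abs_le_abs_sub n j
        have := abs_le.2 (Finset.mem_Icc.1 hj)
        omega
      · intro j hj
        refine hS _ _ ?_
        by_contra h'
        exact hj (Finset.mem_Icc.2 (abs_le.1 (not_lt.1 h')))
    · intro hx
      refine absurd ?_ hx
      rw [Finset.HasAntidiagonal.mem_antidiagonal]
      omega

/-! ### Bounded cone causal systems are dense -/

theorem memLp_monomialL2 (x : ℤ × ℤ) : MemLp (monomialL2 x) ∞ torusMeasure := by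
  refine memLp_top_of_bound (Lp.aestronglyMeasurable _) 1 ?_
  filter_upwards [coeFn_monomialL2 x] with y hy
  rw [hy, norm_mul, fourier_apply, fourier_apply, Circle.norm_coe, Circle.norm_coe, one_mul]

/-- The bounded cone causal elements of `L²`. -/
def boundedConeCausal : Submodule ℂ (Lp ℂ 2 torusMeasure) where
  carrier := {F | IsConeCausal F ∧ MemLp F ∞ torusMeasure}
  add_mem' {F F'} hF hF' := ⟨coneCausal.add_mem hF.1 hF'.1,
    (memLp_congr_ae (Lp.coeFn_add F F')).2 (hF.2.add hF'.2)⟩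
  zero_mem' := ⟨coneCausal.zero_mem, (memLp_congr_ae (Lp.coeFn_zero ..)).2 MemLp.zero⟩
  smul_mem' c F hF := ⟨coneCausal.smul_mem c hF.1,
    (memLp_congr_ae (Lp.coeFn_smul c F)).2 (hF.2.const_smul c)⟩

theorem monomialL2_mem_boundedConeCausal {x : ℤ × ℤ} (hx : |x.1| ≤ x.2) :
    monomialL2 x ∈ boundedConeCausal :=
  ⟨isConeCausal_monomialL2 hx, memLp_monomialL2 x⟩

/-- A finite partial sum of the monomial expansion serves as approximant: its terms outside the cone
vanish, and finite sums of monomials are bounded. -/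
theorem exists_boundedConeCausal_near {F : Lp ℂ 2 torusMeasure} (hF : IsConeCausal F) {ε : ℝ}
    (hε : 0 < ε) : ∃ P ∈ boundedConeCausal, ‖F - P‖ < ε := by
  obtain ⟨s, hs⟩ := ((hasSum_impulse_smul_monomialL2 F).eventually
    (Metric.ball_mem_nhds F hε)).exists
  refine ⟨_, ?_, by simpa [dist_eq_norm, norm_sub_rev] using hs⟩
  refine boundedConeCausal.sum_mem fun x _ => ?_
  by_cases hx : |x.1| ≤ x.2
  · exact boundedConeCausal.smul_mem _ (monomialL2_mem_boundedConeCausal hx)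
  · rw [isConeCausal_iff.1 hF _ _ (not_le.1 hx), zero_smul]
    exact boundedConeCausal.zero_mem

/-- The approximant can be chosen with a well-posed loop. -/
theorem exists_boundedConeCausal_near_of_wellPosed {F : Lp ℂ 2 torusMeasure}
    (hF : IsConeCausal F) (a : ℂ) {ε : ℝ} (hε : 0 < ε) :
    ∃ P ∈ boundedConeCausal, ‖F - P‖ < ε ∧ a * impulse P 0 0 ≠ 1 := by
  obtain ⟨P, hP, hFP⟩ := exists_boundedConeCausal_near hF (half_pos hε)
  by_cases h : a * impulse P 0 0 = 1
  swap
  · exact ⟨P, hP, hFP.trans (half_lt_self hε), h⟩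
  -- Adding the constant `ε / 2` moves the product from `1` to `1 + a ε / 2`, which differs from `1`
  -- because `a ≠ 0`. It uses up the other half of the error budget.
  have ha : a ≠ 0 := left_ne_zero_of_mul_eq_one h
  have hε' : ((ε / 2 : ℝ) : ℂ) ≠ 0 := Complex.ofReal_ne_zero.2 (half_pos hε).ne'
  refine ⟨P + ((ε / 2 : ℝ) : ℂ) • monomialL2 0, boundedConeCausal.add_mem hP
    (boundedConeCausal.smul_mem _ (monomialL2_mem_boundedConeCausal (by simp))), ?_, ?_⟩
  · rw [← sub_sub]
    refine (norm_sub_le _ _).trans_lt ?_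
    rw [norm_smul, orthonormal_monomialL2.1, mul_one, Complex.norm_real,
      Real.norm_of_nonneg (half_pos hε).le]
    linarith
  · rw [impulse_add, impulse_smul, impulse_monomialL2, if_pos Prod.mk_zero_zero, mul_add, h,
      mul_one]
    simpa using And.intro ha hε.ne'

/-! ### The scalar approximation problems -/

theorem norm_spatialCoeff_sub_lambdaMul (D : Lp ℂ 2 torusMeasure) (i : ℤ)
    (h : Lp ℂ 2 circleMeasure) :
    ‖spatialCoeff D i - lambdaMul |i| h‖ = ‖scaledCoeff D i - h‖ := by
  rw [← norm_lambdaMul (-|i|), lambdaMul_sub, lambdaMul_lambdaMul, neg_add_cancel, lambdaMul_zero,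
    scaledCoeff]

theorem etaTilde_mem_hardy (D : Lp ℂ 2 torusMeasure) (i : ℤ) : etaTilde D i ∈ hardy :=
  Submodule.starProjection_apply_mem _ _

theorem norm_sq_sub_etaTilde (D : Lp ℂ 2 torusMeasure) (i : ℤ) :
    ‖spatialCoeff D i - lambdaMul |i| (etaTilde D i)‖ ^ 2 = residualSq D i := by
  rw [norm_spatialCoeff_sub_lambdaMul, residualSq, etaTilde, Submodule.starProjection_orthogonal_val]

/-- Pythagoras: subtracting an element of `H₂` does not change the component orthogonal to `H₂`. -/
theorem residualSq_le (D : Lp ℂ 2 torusMeasure) (i : ℤ) {h : Lp ℂ 2 circleMeasure}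
    (hh : h ∈ hardy) : residualSq D i ≤ ‖spatialCoeff D i - lambdaMul |i| h‖ ^ 2 := by
  rw [norm_spatialCoeff_sub_lambdaMul, Submodule.norm_sq_eq_add_norm_sq_starProjection _ hardy,
    map_sub hardyᗮ.starProjection,
    Submodule.starProjection_orthogonal_apply_eq_zero hh, sub_zero, residualSq]
  exact le_add_of_nonneg_left (sq_nonneg _)

theorem norm_scaledCoeff (D : Lp ℂ 2 torusMeasure) (i : ℤ) :
    ‖scaledCoeff D i‖ = ‖spatialCoeff D i‖ :=
  norm_lambdaMul _ _

theorem summable_norm_sq_etaTilde (D : Lp ℂ 2 torusMeasure) :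
    Summable fun i => ‖etaTilde D i‖ ^ 2 := by
  refine (hasSum_norm_sq_spatialCoeff D).summable.of_nonneg_of_le (fun i => sq_nonneg _) fun i => ?_
  rw [← norm_scaledCoeff]
  exact pow_le_pow_left₀ (norm_nonneg _) (hardy.norm_starProjection_apply_le _) 2

theorem summable_zMul_lambdaMul {h : ℤ → Lp ℂ 2 circleMeasure}
    (hh : Summable fun i => ‖h i‖ ^ 2) : Summable fun i : ℤ => zMul i (lambdaMul |i| (h i)) :=
  summable_zMul_iff.2 (by simpa only [norm_lambdaMul] using hh)

theorem isConeCausal_of_hasSum {h : ℤ → Lp ℂ 2 circleMeasure} (hh : ∀ i, h i ∈ hardy)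
    {F : Lp ℂ 2 torusMeasure} (hF : HasSum (fun i : ℤ => zMul i (lambdaMul |i| (h i))) F) :
    IsConeCausal F :=
  fun i => ⟨h i, hh i, spatialCoeff_of_hasSum hF i⟩

theorem hasSum_norm_sq_spatialCoeff_sub {D F : Lp ℂ 2 torusMeasure}
    {h : ℤ → Lp ℂ 2 circleMeasure} (hF : ∀ i, spatialCoeff F i = lambdaMul |i| (h i)) :
    HasSum (fun i => ‖spatialCoeff D i - lambdaMul |i| (h i)‖ ^ 2) (‖D - F‖ ^ 2) := by
  simpa only [spatialCoeff_sub, hF] using hasSum_norm_sq_spatialCoeff (D - F)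

/-! ### The Youla parametrization -/

theorem isUnit_one_sub_coneSeries_mul_iff {G : Lp ℂ ∞ torusMeasure} {Q : Lp ℂ 2 torusMeasure}
    (hG : IsConeCausal (toL2 G)) (hQ : IsConeCausal Q) :
    IsUnit (1 - coneSeries (toL2 G) * coneSeries Q) ↔
      impulse (toL2 G) 0 0 * impulse Q 0 0 ≠ 1 := by
  have hone : IsConeCausal (monomialL2 0) := isConeCausal_monomialL2 (by simp)
  have hGQ := hG.lmul hQ
  have hF : IsConeCausal (monomialL2 0 - lmul G Q) := coneCausal.sub_mem hone hGQ
  rw [← coneSeries_lmul hG hQ, ← coneSeries_monomialL2_zero, ← coneSeries_sub hone hGQ,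
    (isConeSeries_coneSeries hF).isUnit_iff, coeff_coneSeries hF, impulse_sub,
    Nat.cast_zero, impulse_monomialL2, if_pos Prod.mk_zero_zero,
    impulse_lmul_eq_sum (isStable_of_isConeCausal hG) hQ]
  simp [sub_eq_zero, eq_comm (a := (1 : ℂ))]

/-- This is `1 + g q (1 - g q)⁻¹ = (1 - g q)⁻¹`. Inverting it makes the sensitivity equal to `1 - g
q`, so no inverse remains in the closed-loop maps. -/
theorem one_sub_mul_youlaController {g q : ℂ[T;T⁻¹]⟦X⟧} (h : IsUnit (1 - g * q)) :
    1 - g * youlaController g q = Ring.inverse (1 - g * q) := by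
  have h1 := Ring.mul_inverse_cancel _ h
  rw [youlaController]
  linear_combination -h1

theorem sensitivity_youlaController {g q : ℂ[T;T⁻¹]⟦X⟧} (h : IsUnit (1 - g * q)) :
    sensitivity g (youlaController g q) = 1 - g * q := by
  rw [sensitivity, one_sub_mul_youlaController h]
  obtain ⟨u, hu⟩ := h
  rw [← hu, Ring.inverse_unit, Ring.inverse_unit, inv_inv]

theorem youlaController_mul_sensitivity {g q : ℂ[T;T⁻¹]⟦X⟧} (h : IsUnit (1 - g * q)) :
    youlaController g q * sensitivity g (youlaController g q) = -q := by
  rw [sensitivity_youlaController h, youlaController, mul_assoc, Ring.inverse_mul_cancel _ h,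
    mul_one]

theorem isDecentralizedCost_youlaController {p : ℝ≥0∞} (Gzw Gzu Gyw : Lp ℂ ∞ torusMeasure)
    {Gyu : Lp ℂ ∞ torusMeasure} {Q : Lp ℂ 2 torusMeasure} (hG : IsConeCausal (toL2 Gyu))
    (hQ : IsConeCausal Q) (hQp : MemLp Q p torusMeasure)
    (hu : IsUnit (1 - coneSeries (toL2 Gyu) * coneSeries Q)) :
    IsDecentralizedCost p Gzw Gzu Gyw Gyu (youlaController (coneSeries (toL2 Gyu)) (coneSeries Q))
      ‖toL2 Gzw - lmul (lmul Gzu Gyw) Q‖ := by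
  have hone : IsConeCausal (monomialL2 0) := isConeCausal_monomialL2 (by simp)
  have hGQ := hG.lmul hQ
  have hS : IsConeCausal (monomialL2 0 - lmul Gyu Q) := coneCausal.sub_mem hone hGQ
  have hSp : MemLp (monomialL2 0 - lmul Gyu Q : Lp ℂ 2 torusMeasure) p torusMeasure :=
    (memLp_congr_ae (Lp.coeFn_sub _ _)).2
      (((memLp_monomialL2 0).mono_exponent le_top).sub (memLp_lmul Gyu hQp))
  have hSs : coneSeries (monomialL2 0 - lmul Gyu Q)
      = 1 - coneSeries (toL2 Gyu) * coneSeries Q := by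
    rw [coneSeries_sub hone hGQ, coneSeries_monomialL2_zero, coneSeries_lmul hG hQ]
  have hneg : Realizes p (-Q) (youlaController (coneSeries (toL2 Gyu)) (coneSeries Q) *
      sensitivity (coneSeries (toL2 Gyu))
        (youlaController (coneSeries (toL2 Gyu)) (coneSeries Q))) :=
    ⟨coneCausal.neg_mem hQ, (memLp_congr_ae (Lp.coeFn_neg Q)).2 hQp.neg, by
      rw [youlaController_mul_sensitivity hu, coneSeries_neg hQ]⟩
  -- The three closed-loop maps are `1 - g q`, `-q` and `g (1 - g q)`. They lie in `L^p` with `Q`,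
  -- because `Gyu` is bounded.
  refine ⟨?_, ⟨?_, ?_, ⟨-Q, hneg⟩, ?_⟩, -Q, hneg, ?_⟩
  · refine (isConeSeries_coneSeries hQ).neg.mul (IsConeSeries.inverse ?_)
    rw [← hSs]
    exact isConeSeries_coneSeries hS
  · rw [one_sub_mul_youlaController hu]
    exact hu.ringInverse
  · exact ⟨_, hS, hSp, by rw [hSs, sensitivity_youlaController hu]⟩
  · exact ⟨lmul Gyu (monomialL2 0 - lmul Gyu Q), hG.lmul hS, memLp_lmul Gyu hSp, by
      rw [coneSeries_lmul hG hS, hSs, sensitivity_youlaController hu]⟩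
  · rw [lmul_neg, ← sub_eq_add_neg]

/-! ### The cost -/

/-- An inner factor can be removed from the cost. -/
theorem norm_sub_lmul_of_isInner {U W : Lp ℂ ∞ torusMeasure} (hU : IsInner U)
    (F Q : Lp ℂ 2 torusMeasure) :
    ‖F - lmul (lmul U W) Q‖ = ‖lmul (star U) F - lmul W Q‖ := by
  -- Applying the isometry `U` inside the norm restores `F`, since `U` times its conjugate is `1`.
  rw [← hU.2 (lmul (star U) F - lmul W Q), lmul_sub, lmul_lmul, lmul_lmul, lmul_comm U (star U),
    lmul_star_self_of_isometry hU.2, lmul_one]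

theorem isGLB_of_exists_lt_add {s : Set ℝ} {J : ℝ} (hs : ∀ c ∈ s, J ≤ c)
    (h : ∀ ε > 0, ∃ c ∈ s, c < J + ε) : IsGLB s J :=
  ⟨hs, fun _ hb => le_of_forall_pos_le_add fun ε hε => by
    obtain ⟨c, hc, hlt⟩ := h ε hε
    exact (hb hc).trans hlt.le⟩

end

/-! ### Optimality of `Q` and of the associated controller -/

theorem mainTheorem1
    (Gzw Gzu Gyw Gyu T2in T2out T2outInv : Lp ℂ ∞ torusMeasure)
    (hGzw : IsStable Gzw) (hGzu : IsStable Gzu) (hGyw : IsStable Gyw) (hGyu : IsStable Gyu)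
    (hGyu_cone : IsConeCausal (toL2 Gyu))
    (hfac : lmul Gzu Gyw = lmul T2in T2out)
    (hin : IsInner T2in)
    (hout : IsStable T2out) (hout_cone : IsConeCausal (toL2 T2out))
    (hinv : IsStable T2outInv)
    (hinv_mul : lmul T2out T2outInv = Lp.const ∞ torusMeasure (1 : ℂ))
    (T1 : Lp ℂ 2 torusMeasure) (hT1 : T1 = toL2 Gzw)
    (T2 : Lp ℂ ∞ torusMeasure) (hT2 : T2 = lmul Gzu Gyw)
    (D : Lp ℂ 2 torusMeasure) (hD : D = lmul (star T2in) T1)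
    (Q : Lp ℂ 2 torusMeasure) (hQ : Q = optimalQ T2outInv D)
    (g q : ℂ[T;T⁻¹]⟦X⟧) (hg : g = coneSeries (toL2 Gyu)) (hq : q = coneSeries Q) :
    -- the expansion `T_{2in}^* T_1 = ∑_i T̃_i(λ) z^i`
    HasSum (fun i : ℤ => zMul i (spatialCoeff D i)) D ∧
    -- every cone causal `Q'` gives `T_{2out} Q' = ∑_i λ^{|i|} h_i(λ) z^i` with `h_i ∈ H₂`, and
    -- the cost splits over the spatial index
    (∀ Q' : Lp ℂ 2 torusMeasure, IsConeCausal Q' →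
      ∃ h : ℤ → Lp ℂ 2 circleMeasure,
        (∀ i, h i ∈ hardy ∧ spatialCoeff (lmul T2out Q') i = lambdaMul |i| (h i)) ∧
        Summable (fun i => ‖h i‖ ^ 2) ∧
        HasSum (fun i => ‖spatialCoeff D i - lambdaMul |i| (h i)‖ ^ 2)
          (‖T1 - lmul T2 Q'‖ ^ 2)) ∧
    -- conversely the `h_i ∈ H₂` can be chosen independently
    (∀ h : ℤ → Lp ℂ 2 circleMeasure, (∀ i, h i ∈ hardy) → Summable (fun i => ‖h i‖ ^ 2) →
      ∃ Q' : Lp ℂ 2 torusMeasure, IsConeCausal Q' ∧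
        ∀ i, spatialCoeff (lmul T2out Q') i = lambdaMul |i| (h i)) ∧
    -- each scalar problem is solved by `η̃_i`
    (∀ i : ℤ, etaTilde D i ∈ hardy ∧
      ‖spatialCoeff D i - lambdaMul |i| (etaTilde D i)‖ ^ 2 = residualSq D i ∧
      IsLeast {c : ℝ | ∃ h ∈ hardy, c = ‖spatialCoeff D i - lambdaMul |i| h‖ ^ 2}
        (residualSq D i)) ∧
    -- the candidate `Q`
    Summable (fun i : ℤ => zMul i (lambdaMul |i| (etaTilde D i))) ∧
    IsConeCausal Q ∧
    HasSum (fun i : ℤ => zMul i (lambdaMul |i| (etaTilde D i))) (lmul T2out Q) ∧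
    -- the optimal cost
    ∃ J : ℝ, 0 ≤ J ∧
      HasSum (residualSq D) (J ^ 2) ∧
      IsLeast {c : ℝ | ∃ h : ℤ → Lp ℂ 2 circleMeasure, (∀ i, h i ∈ hardy) ∧
        HasSum (fun i => ‖spatialCoeff D i - lambdaMul |i| (h i)‖ ^ 2) c} (J ^ 2) ∧
      -- `Q` attains the infimum over the Youla parameters
      ‖T1 - lmul T2 Q‖ = J ∧
      (∀ p : ℝ≥0∞, 2 ≤ p →
        IsGLB {c : ℝ | ∃ Q' : Lp ℂ 2 torusMeasure, IsConeCausal Q' ∧ MemLp Q' p torusMeasure ∧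
          c = ‖T1 - lmul T2 Q'‖} J) ∧
      -- `K = -Q (1 - G_yu Q)⁻¹` attains the infimum over the decentralized controllers
      (IsUnit (1 - g * q) ↔ impulse (toL2 Gyu) 0 0 * impulse Q 0 0 ≠ 1) ∧
      (∀ p : ℝ≥0∞, 2 ≤ p →
        IsGLB {c : ℝ | ∃ K : ℂ[T;T⁻¹]⟦X⟧, IsDecentralizedCost p Gzw Gzu Gyw Gyu K c} J ∧
        (MemLp Q p torusMeasure → IsUnit (1 - g * q) →
          IsDecentralizedCost p Gzw Gzu Gyw Gyu (youlaController g q) J)) := by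
  have hinv_cone : IsConeCausal (toL2 T2outInv) := isConeCausal_of_inverse hout_cone hinv hinv_mul
  have hcancel (F : Lp ℂ 2 torusMeasure) : lmul T2out (lmul T2outInv F) = F := by
    rw [lmul_lmul, hinv_mul, lmul_one]
  have hcost (Q' : Lp ℂ 2 torusMeasure) : ‖T1 - lmul T2 Q'‖ = ‖D - lmul T2out Q'‖ := by
    rw [hT2, hfac, hD, norm_sub_lmul_of_isInner hin]
  have hsum : HasSum (fun i : ℤ => zMul i (lambdaMul |i| (etaTilde D i)))
      (lmul T2out Q) := by
    rw [hQ, optimalQ, hcancel]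
    exact (summable_zMul_lambdaMul (summable_norm_sq_etaTilde D)).hasSum
  have hQ_cone : IsConeCausal Q := by
    rw [hQ]
    exact hinv_cone.lmul (isConeCausal_of_hasSum (etaTilde_mem_hardy D)
      (summable_zMul_lambdaMul (summable_norm_sq_etaTilde D)).hasSum)
  have hsplit (Q' : Lp ℂ 2 torusMeasure) (hQ' : IsConeCausal Q') :
      ∃ h : ℤ → Lp ℂ 2 circleMeasure,
        (∀ i, h i ∈ hardy ∧ spatialCoeff (lmul T2out Q') i = lambdaMul |i| (h i)) ∧
        Summable (fun i => ‖h i‖ ^ 2) ∧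
        HasSum (fun i => ‖spatialCoeff D i - lambdaMul |i| (h i)‖ ^ 2)
          (‖T1 - lmul T2 Q'‖ ^ 2) := by
    choose h hh hspat using hout_cone.lmul hQ'
    refine ⟨h, fun i => ⟨hh i, hspat i⟩, ?_, ?_⟩
    · simpa only [hspat, norm_lambdaMul] using
        (hasSum_norm_sq_spatialCoeff (lmul T2out Q')).summable
    · rw [hcost]
      exact hasSum_norm_sq_spatialCoeff_sub hspat
  have hres : HasSum (residualSq D) (‖T1 - lmul T2 Q‖ ^ 2) := by
    rw [hcost]
    simpa only [norm_sq_sub_etaTilde] using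
      hasSum_norm_sq_spatialCoeff_sub (D := D) (spatialCoeff_of_hasSum hsum)
  have hle (Q' : Lp ℂ 2 torusMeasure) (hQ' : IsConeCausal Q') :
      ‖T1 - lmul T2 Q‖ ≤ ‖T1 - lmul T2 Q'‖ := by
    obtain ⟨h, hh, -, hs⟩ := hsplit Q' hQ'
    exact le_of_sq_le_sq (hasSum_le (fun i => residualSq_le D i (hh i).1) hres hs) (norm_nonneg _)
  have happrox (ε : ℝ) (hε : 0 < ε) : ∃ P ∈ boundedConeCausal,
      ‖T1 - lmul T2 P‖ < ‖T1 - lmul T2 Q‖ + ε ∧ impulse (toL2 Gyu) 0 0 * impulse P 0 0 ≠ 1 := by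
    -- Replacing `Q` by `P` changes the cost by at most `‖T2‖ ‖Q - P‖`; the added `1` keeps the
    -- divisor positive when `T2 = 0`.
    have hpos : 0 < ‖T2‖ + 1 := by positivity
    obtain ⟨P, hP, hQP, hne⟩ := exists_boundedConeCausal_near_of_wellPosed hQ_cone
      (impulse (toL2 Gyu) 0 0) (div_pos hε hpos)
    refine ⟨P, hP, ?_, hne⟩
    have h1 : T1 - lmul T2 P = (T1 - lmul T2 Q) + lmul T2 (Q - P) := by
      rw [lmul_sub]
      abel
    rw [lt_div_iff₀ hpos] at hQP
    have h2 := norm_lmul_le T2 (Q - P)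
    have h3 := norm_add_le (T1 - lmul T2 Q) (lmul T2 (Q - P))
    rw [h1]
    nlinarith [norm_nonneg (Q - P)]
  refine ⟨hasSum_zMul_spatialCoeff D, hsplit, ?_, ?_, hsum.summable, hQ_cone, hsum,
    ‖T1 - lmul T2 Q‖, norm_nonneg _, hres, ⟨?_, ?_⟩, rfl, ?_, ?_, ?_⟩
  · intro h hh hs
    have hF := (summable_zMul_lambdaMul hs).hasSum
    refine ⟨lmul T2outInv _, hinv_cone.lmul (isConeCausal_of_hasSum hh hF), fun i => ?_⟩
    rw [hcancel]
    exact spatialCoeff_of_hasSum hF i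
  · refine fun i => ⟨etaTilde_mem_hardy D i, norm_sq_sub_etaTilde D i,
      ⟨_, etaTilde_mem_hardy D i, (norm_sq_sub_etaTilde D i).symm⟩, ?_⟩
    rintro c ⟨h, hh, rfl⟩
    exact residualSq_le D i hh
  · exact ⟨etaTilde D, etaTilde_mem_hardy D, by simpa only [norm_sq_sub_etaTilde] using hres⟩
  · rintro c ⟨h, hh, hc⟩
    exact hasSum_le (fun i => residualSq_le D i (hh i)) hres hc
  · refine fun p _ => isGLB_of_exists_lt_add ?_ fun ε hε => ?_
    · rintro c ⟨Q', hQ', -, rfl⟩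
      exact hle Q' hQ'
    · obtain ⟨P, hP, hlt, -⟩ := happrox ε hε
      -- The bounded approximant lies in every `L^p`, so a single construction serves all exponents.
      exact ⟨_, ⟨P, hP.1, hP.2.mono_exponent le_top, rfl⟩, hlt⟩
  · rw [hg, hq]
    exact isUnit_one_sub_coneSeries_mul_iff hGyu_cone hQ_cone
  · refine fun p _ => ⟨isGLB_of_exists_lt_add ?_ fun ε hε => ?_, fun hQp hu => ?_⟩
    · rintro c ⟨K, -, -, R, hR, rfl⟩
      -- The realization `R` of `K (1 - G K)⁻¹` enters the cost with a plus sign, so the Youla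
      -- parameter to compare with `Q` is `-R`.
      have h := hle (-R) (coneCausal.neg_mem hR.1)
      rw [lmul_neg, sub_neg_eq_add] at h
      rwa [← hT1, ← hT2]
    · obtain ⟨P, hP, hlt, hne⟩ := happrox ε hε
      refine ⟨_, ⟨_, isDecentralizedCost_youlaController Gzw Gzu Gyw hGyu_cone hP.1
        (hP.2.mono_exponent le_top)
        ((isUnit_one_sub_coneSeries_mul_iff hGyu_cone hP.1).2 hne)⟩, ?_⟩
      rwa [← hT1, ← hT2]
    · rw [hg, hq] at hu ⊢
      rw [hT1, hT2]
      exact isDecentralizedCost_youlaController Gzw Gzu Gyw hGyu_cone hQ_cone hQp hu
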